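/- A convex body in $\mathbb{R}^n$ is a compact convex subset of $\mathbb{R}^n$ with non-empty interior; $|\cdot|$ denotes $n$-dimensional Lebesgue measure, and $A+K=\{a+k : a\in A,\ k\in K\}$ is the Minkowski sum. Theorem. Let $n\ge 1$ and let $A,B\subset\mathbb{R}^n$ be convex bodies. (1) If $|A+K|\le |B+K|$ for every convex body $K\subset\mathbb{R}^n$, then there exists $x_0\in\mathbb{R}^n$ such that $A\subseteq B+x_0$. (2) Moreover, the same conclusion holds under the weaker assumption on simplices only: if $|A+\Delta|\le |B+\Delta|$ for every (non-degenerate) $n$-dimensional simplex $\Delta\subset\mathbb{R}^n$, then there exists $x_0\in\mathbb{R}^n$ such that $A\subseteq B+x_0$. -/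

import Mathlib

open MeasureTheory
open scoped Pointwise

/-! ### Linear majorants of positively homogeneous functions. -/

section Superlinear

variable {V : Type*} [AddCommGroup V] [Module ℝ V]

/-! Let `f` be the support function of `A` minus that of `B`. A translate of `B` contains `A` as
soon as a linear functional dominates `f`. By Hahn–Banach (`exists_linearMap_ge_of_sum_nonpos`) such
a functional exists if `∑ f (w i) ≤ 0` whenever `∑ w i = 0`. Conic Carathéodory reduces this to `n +
1` vectors, and a perturbation reduces it to outer normals of a simplex.

For simplex normals, let `T` be a simplex of size `R`. The set `B + T` lies in a circumscribed
simplex of size `R + ∑ h_B (w i)`, while `A + T` fills its own circumscribed simplex except near the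
ridges, a loss of order `R ^ (n - 2)`. Comparing the `R ^ (n - 1)` terms of the volumes gives `∑ h_A
(w i) ≤ ∑ h_B (w i)` (`IsSimplexNormals.sum_supportFun_le`). Only simplices are tested, so (2)
implies (1). -/

/-- Conic Carathéodory reduction: among more than `dim V + 1` vectors one can be removed after
rescaling the others, keeping two given sums. -/
theorem exists_nonneg_reweighting [FiniteDimensional ℝ V] {m : ℕ}
    (hm : Module.finrank ℝ V + 1 ≤ m) (w : Fin (m + 1) → V) (t : Fin (m + 1) → ℝ) :
    ∃ (a : Fin (m + 1) → ℝ) (i₀ : Fin (m + 1)), (∀ i, 0 ≤ a i) ∧ a i₀ = 0 ∧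
      ∑ i, a i • w i = ∑ i, w i ∧ ∑ i, a i * t i = ∑ i, t i := by
  have hdep : ∃ c : Fin (m + 1) → ℝ, ∑ i, c i • w i = 0 ∧ ∑ i, c i * t i = 0 ∧ ∃ i, c i < 0 := by
    have hnot : ¬ LinearIndependent ℝ (fun i => (w i, t i)) := by
      intro h
      have := h.fintype_card_le_finrank
      simp at this
      omega
    obtain ⟨c, hc, i, hi⟩ := Fintype.not_linearIndependent_iff.1 hnot
    have h1 := congrArg Prod.fst hc
    have h2 := congrArg Prod.snd hc
    simp only [Prod.fst_sum, Prod.snd_sum, Prod.smul_fst, Prod.smul_snd, smul_eq_mul,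
      Prod.fst_zero, Prod.snd_zero] at h1 h2
    rcases lt_or_gt_of_ne hi with hi | hi
    · exact ⟨c, h1, h2, i, hi⟩
    · refine ⟨-c, ?_, ?_, i, by simpa using hi⟩
      · simp [h1]
      · simp [h2]
  obtain ⟨c, h1, h2, j, hj⟩ := hdep
  -- Dividing by the most negative coefficient keeps every `1 - c i / c i₀` nonnegative.
  obtain ⟨i₀, -, hi₀⟩ := Finset.exists_min_image Finset.univ c ⟨j, Finset.mem_univ j⟩
  have hneg : c i₀ < 0 := (hi₀ j (Finset.mem_univ j)).trans_lt hj
  refine ⟨fun i => 1 - (c i₀)⁻¹ * c i, i₀, fun i => ?_, ?_, ?_, ?_⟩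
  · have : (c i₀)⁻¹ * c i ≤ (c i₀)⁻¹ * c i₀ :=
      mul_le_mul_of_nonpos_left (hi₀ i (Finset.mem_univ i)) (inv_nonpos.2 hneg.le)
    rw [inv_mul_cancel₀ hneg.ne] at this
    linarith
  · simp [inv_mul_cancel₀ hneg.ne]
  · simp [sub_smul, mul_smul, Finset.sum_sub_distrib, ← Finset.smul_sum, h1]
  · simp [sub_mul, mul_assoc, Finset.sum_sub_distrib, ← Finset.mul_sum, h2]

theorem sum_nonpos_of_sum_nonpos_of_finrank_add_one [FiniteDimensional ℝ V] {f : V → ℝ}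
    (hf : ∀ (c : ℝ) (x : V), 0 ≤ c → f (c • x) = c * f x)
    (h : ∀ w : Fin (Module.finrank ℝ V + 1) → V, ∑ i, w i = 0 → ∑ i, f (w i) ≤ 0)
    (m : ℕ) (w : Fin m → V) (hw : ∑ i, w i = 0) : ∑ i, f (w i) ≤ 0 := by
  have hf0 : f 0 = 0 := by simpa using hf 0 0 le_rfl
  rcases le_total m (Module.finrank ℝ V + 1) with hm | hm
  · induction hm using Nat.decreasingInduction with
    | self => exact h w hw
    | of_succ k _ ih =>
      have := ih (Fin.cons 0 w) (by simp [Fin.sum_univ_succ, hw])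
      simpa [Fin.sum_univ_succ, hf0] using this
  · induction m, hm using Nat.le_induction with
    | base => exact h w hw
    | succ k hk ih =>
      obtain ⟨a, i₀, ha, ha0, h1, h2⟩ := exists_nonneg_reweighting hk w (fun i => f (w i))
      rw [hw, Fin.sum_univ_succAbove _ i₀, ha0, zero_smul, zero_add] at h1
      rw [Fin.sum_univ_succAbove _ i₀, ha0, zero_mul, zero_add] at h2
      rw [← h2]
      simpa only [hf _ _ (ha _)] using ih _ h1

/-- The infimum of `-∑ f (w i)` over finite decompositions of `x` is sublinear and at most `-f x`;
the hypothesis makes it finite. Hahn–Banach from the zero subspace gives a linear minorant, and its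
negative dominates `f`. -/
theorem exists_linearMap_ge_of_sum_nonpos {f : V → ℝ}
    (hf : ∀ (c : ℝ) (x : V), 0 ≤ c → f (c • x) = c * f x)
    (h : ∀ (m : ℕ) (w : Fin m → V), ∑ i, w i = 0 → ∑ i, f (w i) ≤ 0) :
    ∃ φ : V →ₗ[ℝ] ℝ, ∀ x, f x ≤ φ x := by
  let S : V → Set ℝ := fun x => {r | ∃ (m : ℕ) (w : Fin m → V), ∑ i, w i = x ∧ r = -∑ i, f (w i)}
  have hbdd : ∀ x, BddBelow (S x) := by
    refine fun x => ⟨f (-x), ?_⟩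
    rintro r ⟨m, w, hw, rfl⟩
    have := h (m + 1) (Fin.cons (-x) w) (by simp [Fin.sum_univ_succ, hw])
    simp [Fin.sum_univ_succ] at this
    linarith
  have hmem : ∀ x, -f x ∈ S x := fun x => ⟨1, fun _ => x, by simp, by simp⟩
  have hne : ∀ x, (S x).Nonempty := fun x => ⟨_, hmem x⟩
  have hsub : ∀ (c : ℝ), 0 < c → ∀ x, ∀ r ∈ S x, c * r ∈ S (c • x) := by
    rintro c hc x _ ⟨m, w, rfl, rfl⟩
    refine ⟨m, fun i => c • w i, by rw [Finset.smul_sum], ?_⟩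
    simp [hf _ _ hc.le, Finset.mul_sum]
  have hle : ∀ (c : ℝ), 0 < c → ∀ x, sInf (S (c • x)) ≤ c * sInf (S x) := by
    intro c hc x
    rw [← div_le_iff₀' hc]
    refine le_csInf (hne x) fun r hr => ?_
    rw [div_le_iff₀' hc]
    exact csInf_le (hbdd _) (hsub c hc x r hr)
  obtain ⟨g, -, hg⟩ := exists_extension_of_le_sublinear (⊥ : V →ₗ.[ℝ] ℝ) (fun x => sInf (S x))
    (by
      intro c hc x
      refine le_antisymm (hle c hc x) ?_
      have := hle c⁻¹ (inv_pos.2 hc) (c • x)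
      rw [smul_smul, inv_mul_cancel₀ hc.ne', one_smul] at this
      rwa [le_inv_mul_iff₀ hc] at this)
    (by
      intro x y
      rw [← sub_le_iff_le_add]
      refine le_csInf (hne x) ?_
      rintro _ ⟨m, w, rfl, rfl⟩
      rw [sub_le_iff_le_add', ← sub_le_iff_le_add]
      refine le_csInf (hne y) ?_
      rintro _ ⟨k, v, rfl, rfl⟩
      rw [sub_le_iff_le_add]
      refine csInf_le (hbdd _) ⟨m + k, Fin.append w v, ?_, ?_⟩
      · simp [Fin.sum_univ_add]
      · simp [Fin.sum_univ_add])
    (by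
      rintro ⟨x, hx⟩
      obtain rfl : x = 0 := (Submodule.mem_bot ℝ).1 hx
      have h0 : (⊥ : V →ₗ.[ℝ] ℝ) ⟨0, hx⟩ = 0 := map_zero _
      rw [h0]
      refine le_csInf (hne 0) ?_
      rintro _ ⟨m, w, hw, rfl⟩
      linarith [h m w hw])
  exact ⟨-g, fun x => by
    have := (hg x).trans (csInf_le (hbdd x) (hmem x))
    simp only [LinearMap.neg_apply]
    linarith⟩

end Superlinear

/-! ### Support functions and containment. -/

section SupportFunction

variable {F : Type*} [NormedAddCommGroup F] [InnerProductSpace ℝ F]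

/-- The support function of a set. -/
noncomputable def supportFun (K : Set F) (u : F) : ℝ := sSup ((fun x => inner ℝ u x) '' K)

theorem inner_le_supportFun {K : Set F} (hK : IsCompact K) (u : F) {x : F} (hx : x ∈ K) :
    inner ℝ u x ≤ supportFun K u :=
  le_csSup (hK.image (by fun_prop)).bddAbove (Set.mem_image_of_mem _ hx)

theorem exists_inner_eq_supportFun {K : Set F} (hK : IsCompact K) (hne : K.Nonempty) (u : F) :
    ∃ x ∈ K, inner ℝ u x = supportFun K u :=
  (hK.image (by fun_prop)).sSup_mem (hne.image (fun x => inner ℝ u x))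

theorem supportFun_add_le {K : Set F} (hK : IsCompact K) (hne : K.Nonempty) (u v : F) :
    supportFun K (u + v) ≤ supportFun K u + supportFun K v := by
  obtain ⟨x, hx, h⟩ := exists_inner_eq_supportFun hK hne (u + v)
  rw [← h, inner_add_left]
  exact add_le_add (inner_le_supportFun hK u hx) (inner_le_supportFun hK v hx)

theorem supportFun_smul {K : Set F} (hK : IsCompact K) (hne : K.Nonempty) {c : ℝ} (hc : 0 ≤ c)
    (u : F) : supportFun K (c • u) = c * supportFun K u := by
  obtain ⟨x, hx, h⟩ := exists_inner_eq_supportFun hK hne (c • u)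
  obtain ⟨y, hy, h'⟩ := exists_inner_eq_supportFun hK hne u
  refine le_antisymm ?_ ?_
  · rw [← h, real_inner_smul_left]
    exact mul_le_mul_of_nonneg_left (inner_le_supportFun hK u hx) hc
  · rw [← h', ← real_inner_smul_left]
    exact inner_le_supportFun hK _ hy

/-- Containment up to translation, from a linear bound on the difference of support functions. -/
theorem exists_subset_add_singleton_of_supportFun_sub_le [FiniteDimensional ℝ F] {A B : Set F}
    (hA : IsCompact A) (hB : IsCompact B) (hBc : Convex ℝ B) (φ : F →ₗ[ℝ] ℝ)
    (h : ∀ u, supportFun A u - supportFun B u ≤ φ u) (hBne : B.Nonempty) :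
    ∃ x₀ : F, A ⊆ B + {x₀} := by
  refine ⟨(InnerProductSpace.toDual ℝ F).symm (LinearMap.toContinuousLinearMap φ), fun a ha => ?_⟩
  set x₀ := (InnerProductSpace.toDual ℝ F).symm (LinearMap.toContinuousLinearMap φ) with hx₀
  have hφ : ∀ u, φ u = inner ℝ u x₀ := fun u => by
    rw [real_inner_comm, hx₀, InnerProductSpace.toDual_symm_apply]; rfl
  suffices hs : a - x₀ ∈ B from ⟨a - x₀, hs, x₀, rfl, sub_add_cancel _ _⟩
  by_contra hnot
  obtain ⟨g, s, hg1, hg2⟩ := geometric_hahn_banach_closed_point hBc hB.isClosed hnot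
  set u := (InnerProductSpace.toDual ℝ F).symm g
  have hu : ∀ x, g x = inner ℝ u x := fun x => (InnerProductSpace.toDual_symm_apply).symm
  obtain ⟨b, hb, hb'⟩ := exists_inner_eq_supportFun hB hBne u
  have h1 := hg1 b hb
  have h2 := inner_le_supportFun hA u ha
  have h3 := h u
  rw [hu, inner_sub_right] at hg2
  rw [hu] at h1
  rw [hφ] at h3
  linarith

end SupportFunction

/-! ### Simplices with prescribed normals and their volumes. -/

section SimplexNormals

variable {n : ℕ}

local notation "E" => EuclideanSpace ℝ (Fin n)

/-- The vectors `w 0, …, w n` sum to zero and have no other linear relation: they are, up to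
scaling, the outer normals of a simplex. -/
structure IsSimplexNormals (w : Fin (n + 1) → EuclideanSpace ℝ (Fin n)) : Prop where
  sum_eq_zero : ∑ i, w i = 0
  eq_of_sum_smul_eq_zero : ∀ g : Fin (n + 1) → ℝ, ∑ i, g i • w i = 0 → ∀ i j, g i = g j

/-- Move towards a basis and minus its sum: an extra relation would make `-ε` an eigenvalue of `T`,
which excludes finitely many `ε`. The direction `e` does not depend on `η`, so later errors are
linear in `ε`. -/
theorem exists_isSimplexNormals_perturbation (w : Fin (n + 1) → EuclideanSpace ℝ (Fin n))
    (hw : ∑ i, w i = 0) : ∃ e : Fin (n + 1) → EuclideanSpace ℝ (Fin n), ∀ η : ℝ, 0 < η →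
      ∃ ε : ℝ, 0 < ε ∧ ε < η ∧ IsSimplexNormals (fun i => w i + ε • e i) := by
  let b := (EuclideanSpace.basisFun (Fin n) ℝ).toBasis
  let T : Module.End ℝ E := b.constr ℝ (fun i => w i.succ)
  have hT : ∀ i, T (b i) = w i.succ := fun i => b.constr_basis ℝ _ i
  refine ⟨Fin.cons (-∑ i, b i) b, fun η hη => ?_⟩
  have hfin : {ε : ℝ | T.HasEigenvalue (-ε)}.Finite :=
    T.finite_hasEigenvalue.preimage (neg_injective.injOn)
  obtain ⟨ε, ⟨hε0, hεη⟩, hε⟩ := (Set.Ioo_infinite hη).exists_notMem_finite hfin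
  refine ⟨ε, hε0, hεη, ?_, ?_⟩
  · rw [Finset.sum_add_distrib, hw, ← Finset.smul_sum, Fin.sum_univ_succ]
    simp
  · intro g hg
    have hzero : ∑ i : Fin n, (g i.succ - g 0) • b i = 0 := by
      by_contra hne
      refine hε (Module.End.hasEigenvalue_of_hasEigenvector
        (x := ∑ i : Fin n, (g i.succ - g 0) • b i) ⟨?_, hne⟩)
      rw [Module.End.mem_eigenspace_iff, map_sum]
      simp only [map_smul, hT]
      rw [Fin.sum_univ_succ] at hw hg
      rw [eq_neg_of_add_eq_zero_left hw] at hg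
      have e1 : ∑ i : Fin n, g i.succ • (w i.succ + ε • b i) =
          ∑ i : Fin n, g i.succ • w i.succ + ε • ∑ i : Fin n, g i.succ • b i := by
        simp only [smul_add, Finset.sum_add_distrib, Finset.smul_sum, smul_comm ε]
      have e2 : ∀ v : Fin n → E, ∑ i : Fin n, (g i.succ - g 0) • v i =
          ∑ i : Fin n, g i.succ • v i - g 0 • ∑ i, v i := fun v => by
        simp only [sub_smul, Finset.sum_sub_distrib, Finset.smul_sum]
      simp only [Fin.cons_zero, Fin.cons_succ] at hg
      rw [e1] at hg
      rw [e2, e2, eq_comm, ← sub_eq_zero, ← neg_eq_zero, ← hg]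
      module
    have key : ∀ i : Fin n, g i.succ = g 0 := fun i =>
      sub_eq_zero.1 (Fintype.linearIndependent_iff.1 b.linearIndependent _ hzero i)
    have key' : ∀ i, g i = g 0 := fun i => Fin.cases rfl key i
    exact fun i j => (key' i).trans (key' j).symm

namespace IsSimplexNormals

variable {w : Fin (n + 1) → EuclideanSpace ℝ (Fin n)}

theorem exists_linearEquiv (hw : IsSimplexNormals w) (l : Fin (n + 1)) :
    ∃ L : E ≃ₗ[ℝ] (Fin n → ℝ), ∀ x i, L x i = inner ℝ (w (l.succAbove i)) x := by
  have hli : LinearIndependent ℝ (fun i => w (l.succAbove i)) := by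
    refine Fintype.linearIndependent_iff.2 fun g hg i => ?_
    have := hw.eq_of_sum_smul_eq_zero (l.insertNth 0 g)
      (by simpa [Fin.sum_univ_succAbove _ l] using hg) (l.succAbove i) l
    simpa using this
  have hspan := hli.span_eq_top_of_card_eq_finrank' (by simp)
  let f : E →ₗ[ℝ] (Fin n → ℝ) := LinearMap.pi fun i => (innerₗ E) (w (l.succAbove i))
  have hf : ∀ x i, f x i = inner ℝ (w (l.succAbove i)) x := fun x i => rfl
  have hinj : Function.Injective f := by
    rw [← LinearMap.ker_eq_bot, LinearMap.ker_eq_bot']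
    intro x hx
    have hall : ∀ v ∈ Submodule.span ℝ (Set.range fun i => w (l.succAbove i)),
        inner ℝ v x = 0 := by
      intro v hv
      induction hv using Submodule.span_induction with
      | mem v hv => obtain ⟨i, rfl⟩ := hv; exact congrFun hx i
      | zero => simp
      | add u v _ _ hu hv => rw [inner_add_left, hu, hv, add_zero]
      | smul c v _ hv => rw [real_inner_smul_left, hv, mul_zero]
    exact inner_self_eq_zero.1 (hall x (by rw [hspan]; trivial))
  exact ⟨f.linearEquivOfInjective hinj (by simp), fun x i => hf x i⟩

theorem sum_inner (hw : IsSimplexNormals w) (x : EuclideanSpace ℝ (Fin n)) :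
    ∑ i, inner ℝ (w i) x = 0 := by
  rw [← _root_.sum_inner, hw.sum_eq_zero, inner_zero_left]

end IsSimplexNormals

theorem Affine.Simplex.interior_convexHull_nonempty
    (Δ : Affine.Simplex ℝ (EuclideanSpace ℝ (Fin n)) n) :
    (interior (convexHull ℝ (Set.range Δ.points))).Nonempty := by
  rw [interior_convexHull_nonempty_iff_affineSpan_eq_top,
    Δ.independent.affineSpan_eq_top_iff_card_eq_finrank_add_one]
  simp

/-- The intersection of the half-spaces `⟪w i, x⟫ ≤ h i`. -/
def halfSpaceInter (w : Fin (n + 1) → EuclideanSpace ℝ (Fin n)) (h : Fin (n + 1) → ℝ) :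
    Set (EuclideanSpace ℝ (Fin n)) := {x | ∀ i, inner ℝ (w i) x ≤ h i}

theorem convex_halfSpaceInter (w : Fin (n + 1) → EuclideanSpace ℝ (Fin n))
    (h : Fin (n + 1) → ℝ) : Convex ℝ (halfSpaceInter w h) := by
  have : halfSpaceInter w h = ⋂ i, {x | inner ℝ (w i) x ≤ h i} := by
    ext; simp [halfSpaceInter]
  rw [this]
  exact convex_iInter fun i => convex_halfSpace_le ((innerₗ E) (w i)).isLinear _

namespace IsSimplexNormals

variable {w : Fin (n + 1) → EuclideanSpace ℝ (Fin n)}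

/-- In the coordinates `L` this is the corner `y ≤ 0`, `-∑ y i ≤ R`, with vertices `0` and `-R`
times the unit vectors. -/
theorem exists_simplex (hw : IsSimplexNormals w) {R : ℝ} (hR : 0 < R) :
    ∃ Δ : Affine.Simplex ℝ (EuclideanSpace ℝ (Fin n)) n,
      convexHull ℝ (Set.range Δ.points) = halfSpaceInter w (Pi.single 0 R) := by
  obtain ⟨L, hL⟩ := hw.exists_linearEquiv 0
  simp only [Fin.succAbove_zero] at hL
  let p : Fin (n + 1) → E := Fin.cons 0 fun i => L.symm (Pi.single i (-R))
  have hp0 : p 0 = 0 := rfl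
  have hps : ∀ i : Fin n, p i.succ = L.symm (Pi.single i (-R)) := fun i => rfl
  have hLsum : ∀ c : Fin (n + 1) → ℝ, ∀ i, L (∑ j, c j • p j) i = c i.succ * -R := by
    intro c i
    simp [Fin.sum_univ_succ, hp0, hps, Pi.single_apply]
  have h0 : ∀ x, inner ℝ (w 0) x = -∑ i : Fin n, L x i := by
    intro x
    have := hw.sum_inner x
    rw [Fin.sum_univ_succ] at this
    simp only [hL]
    linarith
  have hind : AffineIndependent ℝ p := by
    rw [affineIndependent_iff]
    intro s c hc hs i hi
    let g : Fin (n + 1) → ℝ := fun i => if i ∈ s then c i else 0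
    have hg : ∑ j, g j • p j = 0 := by simpa [g, ite_smul] using hs
    have hgs : ∀ i : Fin n, g i.succ = 0 := fun i => by
      have := hLsum g i
      rw [hg, map_zero, Pi.zero_apply, zero_eq_mul] at this
      exact this.resolve_right (by linarith)
    have hg0 : g 0 = 0 := by
      have : ∑ j, g j = 0 := by simpa [g] using hc
      simpa [Fin.sum_univ_succ, hgs] using this
    have : g i = 0 := Fin.cases hg0 hgs i
    simpa [g, hi] using this
  refine ⟨⟨p, hind⟩, Set.Subset.antisymm (convexHull_min ?_ (convex_halfSpaceInter w _)) ?_⟩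
  · rintro _ ⟨j, rfl⟩ i
    refine Fin.cases ?_ (fun i => ?_) i
    · rw [h0]
      refine Fin.cases ?_ (fun j => ?_) j
      · simp [hp0, hR.le]
      · simp [hps]
    · rw [← hL]
      refine Fin.cases ?_ (fun j => ?_) j
      · simp [hp0]
      · by_cases hij : i = j
        · simp [hps, hij, hR.le]
        · simp [hps, hij]
  · intro x hx
    have hx0 := hx 0
    rw [h0, Pi.single_eq_same] at hx0
    have hxs : ∀ i : Fin n, L x i ≤ 0 := fun i => by
      have := hx i.succ
      rw [← hL] at this
      simpa using this
    let c : Fin (n + 1) → ℝ := Fin.cons (1 - ∑ i, L x i / -R) fun i => L x i / -R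
    refine mem_convexHull_of_exists_fintype c p (fun i => ?_) ?_ (fun i => ⟨i, rfl⟩) ?_
    · refine Fin.cases ?_ (fun i => ?_) i
      · simp only [c, Fin.cons_zero]
        rw [← Finset.sum_div, div_neg, ← neg_div, sub_nonneg, div_le_one hR]
        exact hx0
      · exact div_nonneg_of_nonpos (hxs i) (by linarith)
    · simp [c, Fin.sum_univ_succ]
    · apply L.injective
      ext i
      rw [hLsum]
      simp only [c, Fin.cons_succ]
      field_simp

/-- Since `∑ w i = 0`, translations preserve `∑ h i`; moving the vertex opposite facet `0` to the
origin leaves a dilate by that sum. -/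
theorem volume_halfSpaceInter (hw : IsSimplexNormals w) (h : Fin (n + 1) → ℝ)
    (hR : 0 < ∑ i, h i) : volume (halfSpaceInter w h) =
      ENNReal.ofReal ((∑ i, h i) ^ n) * volume (halfSpaceInter w (Pi.single 0 1)) := by
  obtain ⟨L, hL⟩ := hw.exists_linearEquiv 0
  simp only [Fin.succAbove_zero] at hL
  set R := ∑ i, h i with hRdef
  let x₀ : E := L.symm fun i => h i.succ
  have hx₀ : ∀ i : Fin n, inner ℝ (w i.succ) x₀ = h i.succ := fun i => by
    rw [← hL]; simp [x₀]
  have hx₀0 : inner ℝ (w 0) x₀ = h 0 - R := by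
    have := hw.sum_inner x₀
    rw [Fin.sum_univ_succ] at this
    simp only [hx₀] at this
    rw [Fin.sum_univ_succ] at hRdef
    linarith
  have hset : halfSpaceInter w h =
      (fun x => x + -x₀) ⁻¹' ((R⁻¹ • ·) ⁻¹' halfSpaceInter w (Pi.single 0 1)) := by
    ext x
    simp only [halfSpaceInter, Set.mem_ofPred_eq, Set.mem_preimage]
    refine forall_congr' fun i => ?_
    rw [real_inner_smul_right, inner_add_right, inner_neg_right, inv_mul_le_iff₀ hR]
    refine Fin.cases ?_ (fun i => ?_) i
    · rw [hx₀0, Pi.single_eq_same]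
      constructor <;> intro h <;> linarith
    · rw [hx₀, Pi.single_eq_of_ne (Fin.succ_ne_zero i)]
      constructor <;> intro h <;> linarith
  rw [hset, measure_preimage_add_right, Measure.addHaar_preimage_smul _ (inv_ne_zero hR.ne')]
  simp [abs_of_pos hR]

/-- The slacks `h i - ⟪w i, x⟫` are nonnegative with sum `R = ∑ h i`. Using all normals but a third
one as coordinates puts the set in a box with two sides `M` and the others `R`. With no third
normal, two slacks at most `M` cannot sum to more than `2 * M`. -/
theorem exists_volume_thin_pair_le (hw : IsSimplexNormals w) {j k : Fin (n + 1)} (hjk : j ≠ k) :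
    ∃ C : ℝ, 0 ≤ C ∧ ∀ (h : Fin (n + 1) → ℝ) (M : ℝ), 0 ≤ M → 2 * M < ∑ i, h i →
      volume {x ∈ halfSpaceInter w h |
        h j - inner ℝ (w j) x ≤ M ∧ h k - inner ℝ (w k) x ≤ M} ≤
      ENNReal.ofReal (C * (M ^ 2 * (∑ i, h i) ^ n / (∑ i, h i) ^ 2)) := by
  have hsum : ∀ (h : Fin (n + 1) → ℝ) x, ∑ i, (h i - inner ℝ (w i) x) = ∑ i, h i := fun h x => by
    rw [Finset.sum_sub_distrib, hw.sum_inner, sub_zero]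
  by_cases hl : ∃ l, l ≠ j ∧ l ≠ k
  · obtain ⟨l, hlj, hlk⟩ := hl
    obtain ⟨j, rfl⟩ := Fin.exists_succAbove_eq hlj.symm
    obtain ⟨k, rfl⟩ := Fin.exists_succAbove_eq hlk.symm
    have hjk' : j ≠ k := fun h => hjk (by rw [h])
    obtain ⟨L, hL⟩ := hw.exists_linearEquiv l
    let L' := L.toContinuousLinearEquiv
    have hHaar : (Measure.map L' (volume : Measure E)).IsAddHaarMeasure :=
      L'.isAddHaarMeasure_map volume
    have hmap := Measure.isAddLeftInvariant_eq_smul (Measure.map L' (volume : Measure E)) volume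
    set c := Measure.addHaarScalarFactor (Measure.map L' (volume : Measure E)) volume
    refine ⟨c, c.2, fun h M hM hR => ?_⟩
    set R := ∑ i, h i with hRdef
    have hR0 : 0 < R := by linarith
    let g : Fin n → ℝ := fun i => (if i = j then M / R else 1) * (if i = k then M / R else 1) * R
    let box : Set (Fin n → ℝ) :=
      Set.univ.pi fun i => Set.Icc (h (l.succAbove i) - g i) (h (l.succAbove i))
    have hgpos : ∀ i, 0 ≤ g i := fun i => by
      refine mul_nonneg (mul_nonneg ?_ ?_) hR0.le <;> split_ifs <;> positivity
    have hsub : {x ∈ halfSpaceInter w h | h (l.succAbove j) - inner ℝ (w (l.succAbove j)) x ≤ M ∧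
        h (l.succAbove k) - inner ℝ (w (l.succAbove k)) x ≤ M} ⊆ L' ⁻¹' box := by
      rintro x ⟨hx, hxj, hxk⟩ i -
      have hLi : L' x i = inner ℝ (w (l.succAbove i)) x := hL x i
      rw [hLi]
      refine ⟨?_, hx _⟩
      rw [sub_le_comm]
      by_cases hij : i = j
      · subst hij
        simpa [g, hjk', div_mul_cancel₀ _ hR0.ne'] using hxj
      by_cases hik : i = k
      · subst hik
        simpa [g, hij, div_mul_cancel₀ _ hR0.ne'] using hxk
      · simp only [g, hij, hik, if_false, one_mul]
        rw [hRdef, ← hsum h x]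
        exact Finset.single_le_sum (f := fun i => h i - inner ℝ (w i) x)
          (fun i _ => sub_nonneg.2 (hx i)) (Finset.mem_univ _)
    have hbox : volume box = ENNReal.ofReal (M ^ 2 * R ^ n / R ^ 2) := by
      rw [volume_pi_pi]
      simp only [Real.volume_Icc, sub_sub_cancel]
      rw [← ENNReal.ofReal_prod_of_nonneg fun i _ => hgpos i]
      congr 1
      simp only [g, Finset.prod_mul_distrib, Finset.prod_ite_eq', Finset.mem_univ, if_true,
        Finset.prod_const, Finset.card_univ, Fintype.card_fin]
      field_simp
    refine (measure_mono hsub).trans ?_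
    rw [← Measure.map_apply L'.continuous.measurable
      (MeasurableSet.univ_pi fun i => measurableSet_Icc), hmap, Measure.smul_apply, hbox,
      ENNReal.ofReal_mul (p := (c : ℝ)) c.2, ENNReal.ofReal_coe_nnreal]
    rfl
  · push Not at hl
    refine ⟨0, le_rfl, fun h M hM hR => ?_⟩
    rw [show {x ∈ halfSpaceInter w h | h j - inner ℝ (w j) x ≤ M ∧ h k - inner ℝ (w k) x ≤ M} = ∅
      from ?_]
    · simp
    · refine Set.eq_empty_of_forall_notMem ?_
      rintro x ⟨-, hxj, hxk⟩
      have huniv : (Finset.univ : Finset (Fin (n + 1))) = {j, k} := by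
        ext i
        by_cases hi : i = j
        · simp [hi]
        · simp [hl i hi]
      have := hsum h x
      rw [← this, huniv, Finset.sum_pair hjk] at hR
      linarith

/-- The points of a large simplex that are close to at least two facets form a set whose volume
is of order `R ^ (n - 2)`. -/
theorem exists_volume_thin_le (hw : IsSimplexNormals w) : ∃ C : ℝ, 0 ≤ C ∧
    ∀ (h : Fin (n + 1) → ℝ) (M : ℝ), 0 ≤ M → 2 * M < ∑ i, h i →
      volume {x ∈ halfSpaceInter w h | ∃ j k, j ≠ k ∧
        h j - inner ℝ (w j) x ≤ M ∧ h k - inner ℝ (w k) x ≤ M} ≤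
      ENNReal.ofReal (C * (M ^ 2 * (∑ i, h i) ^ n / (∑ i, h i) ^ 2)) := by
  choose C hC0 hC using fun p : {p : Fin (n + 1) × Fin (n + 1) // p.1 ≠ p.2} =>
    hw.exists_volume_thin_pair_le p.2
  refine ⟨∑ p, C p, Finset.sum_nonneg fun p _ => hC0 p, fun h M hM hR => ?_⟩
  have hR0 : 0 < ∑ i, h i := by linarith
  calc _ ≤ volume (⋃ p : {p : Fin (n + 1) × Fin (n + 1) // p.1 ≠ p.2}, {x ∈ halfSpaceInter w h |
        h p.1.1 - inner ℝ (w p.1.1) x ≤ M ∧ h p.1.2 - inner ℝ (w p.1.2) x ≤ M}) := by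
        refine measure_mono ?_
        rintro x ⟨hx, j, k, hjk, hxjk⟩
        exact Set.mem_iUnion.2 ⟨⟨(j, k), hjk⟩, hx, hxjk⟩
    _ ≤ ∑ p, _ := measure_iUnion_fintype_le _ _
    _ ≤ ∑ p, ENNReal.ofReal (C p * (M ^ 2 * (∑ i, h i) ^ n / (∑ i, h i) ^ 2)) :=
        Finset.sum_le_sum fun p _ => hC p h M hM hR
    _ = _ := by
        rw [← ENNReal.ofReal_sum_of_nonneg fun p _ => mul_nonneg (hC0 p) (by positivity),
          Finset.sum_mul]

end IsSimplexNormals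

end SimplexNormals

/-! ### Asymptotic volume comparison and conclusion. -/

section Volume

variable {n : ℕ} {w : Fin (n + 1) → EuclideanSpace ℝ (Fin n)}
  {A B : Set (EuclideanSpace ℝ (Fin n))}

theorem add_halfSpaceInter_subset (hB : IsCompact B) (h : Fin (n + 1) → ℝ) :
    B + halfSpaceInter w h ⊆ halfSpaceInter w (fun i => supportFun B (w i) + h i) := by
  rintro _ ⟨b, hb, x, hx, rfl⟩ i
  simp only [inner_add_right]
  exact add_le_add (inner_le_supportFun hB _ hb) (hx i)

/-- `A + T` fills the circumscribed copy of the simplex `T` except near its ridges, uniformly in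
the size of `T`. -/
theorem exists_halfSpaceInter_subset_union (hA : IsCompact A) (hne : A.Nonempty)
    (w : Fin (n + 1) → EuclideanSpace ℝ (Fin n)) :
    ∃ M : ℝ, 0 ≤ M ∧ ∀ h : Fin (n + 1) → ℝ,
      halfSpaceInter w (fun i => supportFun A (w i) + h i) ⊆ (A + halfSpaceInter w h) ∪
        {x ∈ halfSpaceInter w (fun i => supportFun A (w i) + h i) | ∃ j k, j ≠ k ∧
          supportFun A (w j) + h j - inner ℝ (w j) x ≤ M ∧
          supportFun A (w k) + h k - inner ℝ (w k) x ≤ M} := by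
  choose p hp hpw using fun i => exists_inner_eq_supportFun hA hne (w i)
  have hnonneg : ∀ i j, 0 ≤ supportFun A (w j) - inner ℝ (w j) (p i) := fun i j =>
    sub_nonneg.2 (inner_le_supportFun hA _ (hp i))
  let M := ∑ i, ∑ j, (supportFun A (w j) - inner ℝ (w j) (p i))
  have hM : ∀ i j, supportFun A (w j) - inner ℝ (w j) (p i) ≤ M := fun i j =>
    (Finset.single_le_sum (f := fun j => supportFun A (w j) - inner ℝ (w j) (p i))
      (fun j _ => hnonneg i j) (Finset.mem_univ j)).trans
    (Finset.single_le_sum (f := fun i => ∑ j, (supportFun A (w j) - inner ℝ (w j) (p i)))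
      (fun i _ => Finset.sum_nonneg fun j _ => hnonneg i j) (Finset.mem_univ i))
  refine ⟨M, Finset.sum_nonneg fun i _ => Finset.sum_nonneg fun j _ => hnonneg i j,
    fun h x hx => ?_⟩
  by_cases hxA : x ∈ A + halfSpaceInter w h
  · exact Or.inl hxA
  -- Translating by the contact point `p i` can only violate a facet `j ≠ i`, and then `x` is within
  -- `M` of it. Using this at `0`, then at the `j` obtained, gives two distinct facets.
  have key : ∀ i, ∃ j, j ≠ i ∧ supportFun A (w j) + h j - inner ℝ (w j) x ≤ M := by
    intro i
    have hnot : x - p i ∉ halfSpaceInter w h := fun hmem =>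
      hxA ⟨p i, hp i, x - p i, hmem, add_sub_cancel _ _⟩
    simp only [halfSpaceInter, Set.mem_ofPred_eq, not_forall, not_le, inner_sub_right] at hnot
    obtain ⟨j, hj⟩ := hnot
    refine ⟨j, ?_, ?_⟩
    · rintro rfl
      have := hx j
      rw [hpw] at hj
      linarith
    · linarith [hM i j]
  obtain ⟨j, -, hj⟩ := key 0
  obtain ⟨k, hkj, hk⟩ := key j
  exact Or.inr ⟨hx, j, k, hkj.symm, hj, hk⟩

/-- Comparing `|A + T|` and `|B + T|` for large dilates `T` of a fixed simplex compares the sums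
of the support functions at its normals. -/
theorem IsSimplexNormals.sum_supportFun_le (hw : IsSimplexNormals w) (hn : 1 ≤ n)
    (hA : IsCompact A) (hAne : A.Nonempty) (hB : IsCompact B)
    (hvol : ∀ R : ℝ, 0 < R → volume (A + halfSpaceInter w (Pi.single 0 R)) ≤
      volume (B + halfSpaceInter w (Pi.single 0 R))) :
    ∑ i, supportFun A (w i) ≤ ∑ i, supportFun B (w i) := by
  by_contra! hlt
  obtain ⟨M, hM, hcover⟩ := exists_halfSpaceInter_subset_union hA hAne w
  obtain ⟨C, hC, hthin⟩ := hw.exists_volume_thin_le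
  set α := ∑ i, supportFun A (w i)
  set β := ∑ i, supportFun B (w i)
  obtain ⟨Δ, hΔ⟩ := hw.exists_simplex one_pos
  have hpos : 0 < volume (halfSpaceInter w (Pi.single 0 1)) := by
    rw [← hΔ]
    exact (isOpen_interior.measure_pos volume Δ.interior_convexHull_nonempty).trans_le
      (measure_mono interior_subset)
  have hfin : volume (halfSpaceInter w (Pi.single 0 1)) ≠ ⊤ := by
    rw [← hΔ]
    exact ((Set.finite_range Δ.points).isCompact_convexHull (𝕜 := ℝ)).measure_ne_top
  set V := (volume (halfSpaceInter w (Pi.single 0 1))).toReal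
  have hV0 : 0 < V := ENNReal.toReal_pos hpos.ne' hfin
  have hVeq : volume (halfSpaceInter w (Pi.single 0 1)) = ENNReal.ofReal V :=
    (ENNReal.ofReal_toReal hfin).symm
  have hsum : ∀ (K : Set (EuclideanSpace ℝ (Fin n))) (R : ℝ),
      ∑ i, (supportFun K (w i) + (Pi.single 0 R : Fin (n + 1) → ℝ) i) =
        ∑ i, supportFun K (w i) + R := fun K R => by
    rw [Finset.sum_add_distrib]; simp
  -- `X = R + α` is the size of the simplex around `A + T`; the one around `B + T` has size `X - (α
  -- - β)`.
  have hineq : ∀ X : ℝ, 2 * M < X → α < X → α - β < X →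
      X ^ n * V ≤ (X - (α - β)) ^ n * V + C * (M ^ 2 * X ^ n / X ^ 2) := by
    intro X hX1 hX2 hX3
    have hX0 : 0 < X := by linarith
    have hR : 0 < X - α := by linarith
    have h1 := hw.volume_halfSpaceInter
      (fun i => supportFun A (w i) + (Pi.single 0 (X - α) : Fin (n + 1) → ℝ) i)
      (by rw [hsum]; simpa [α] using hX0)
    have h2 := hw.volume_halfSpaceInter
      (fun i => supportFun B (w i) + (Pi.single 0 (X - α) : Fin (n + 1) → ℝ) i)
      (by rw [hsum]; change 0 < β + (X - α); linarith)
    have h3 := hthin (fun i => supportFun A (w i) + (Pi.single 0 (X - α) : Fin (n + 1) → ℝ) i)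
      M hM (by rw [hsum]; change 2 * M < α + (X - α); linarith)
    rw [hsum] at h1 h2 h3
    rw [show ∑ i, supportFun A (w i) + (X - α) = X from add_sub_cancel _ _] at h1 h3
    rw [show ∑ i, supportFun B (w i) + (X - α) = X - (α - β) by change β + _ = _; ring] at h2
    have hX3' : 0 < X - (α - β) := by linarith
    have hle := (measure_mono (hcover (Pi.single 0 (X - α)))).trans
      (measure_union_le (μ := volume) _ _)
    have hle' := hle.trans (add_le_add ((hvol _ hR).trans
      (measure_mono (add_halfSpaceInter_subset hB _))) h3)
    rw [h1, h2, hVeq, ← ENNReal.ofReal_mul (by positivity), ← ENNReal.ofReal_mul (by positivity),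
      ← ENNReal.ofReal_add (by positivity) (by positivity),
      ENNReal.ofReal_le_ofReal_iff (by positivity)] at hle'
    exact hle'
  have hδ : 0 < α - β := by linarith
  set δ := α - β
  have hbound : ∀ X : ℝ, 2 * M < X → α < X → δ < X → X * (δ * V) ≤ C * M ^ 2 := by
    intro X hX1 hX2 hX3
    have hX0 : 0 < X := by linarith
    obtain ⟨m, rfl⟩ : ∃ m, n = m + 1 := ⟨n - 1, by omega⟩
    have h1 := hineq X hX1 hX2 hX3
    have h2 : (X - δ) ^ (m + 1) ≤ X ^ m * (X - δ) := by
      rw [pow_succ]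
      have : (X - δ) ^ m ≤ X ^ m := pow_le_pow_left₀ (by linarith) (by linarith) m
      exact mul_le_mul_of_nonneg_right this (by linarith)
    have h3 : X ^ m * δ * V ≤ C * (M ^ 2 * X ^ (m + 1) / X ^ 2) := by
      have := mul_le_mul_of_nonneg_right h2 hV0.le
      rw [pow_succ X m] at h1 ⊢
      linarith
    have h4 : C * (M ^ 2 * X ^ (m + 1) / X ^ 2) = X ^ m * (C * M ^ 2 / X) := by
      field_simp
      ring
    rw [h4, mul_assoc] at h3
    have h5 := le_of_mul_le_mul_left h3 (pow_pos hX0 m)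
    rwa [le_div_iff₀ hX0, mul_comm] at h5
  have hlarge := hbound (2 * M + |α| + δ + 1 + C * M ^ 2 / (δ * V))
  have hq : 0 ≤ C * M ^ 2 / (δ * V) := by positivity
  have := hlarge (by linarith [abs_nonneg α]) (by linarith [le_abs_self α])
    (by linarith [abs_nonneg α])
  rw [add_mul, div_mul_cancel₀ _ (by positivity)] at this
  have : 0 < (2 * M + |α| + δ + 1) * (δ * V) := by positivity
  linarith

theorem exists_subset_add_singleton_of_volume_add_simplex_le (hn : 1 ≤ n)
    (hA : IsCompact A) (hAne : A.Nonempty) (hB : IsCompact B) (hBc : Convex ℝ B)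
    (hBne : B.Nonempty)
    (hvol : ∀ Δ : Affine.Simplex ℝ (EuclideanSpace ℝ (Fin n)) n,
      volume (A + convexHull ℝ (Set.range Δ.points)) ≤
        volume (B + convexHull ℝ (Set.range Δ.points))) :
    ∃ x₀ : EuclideanSpace ℝ (Fin n), A ⊆ B + {x₀} := by
  let f : EuclideanSpace ℝ (Fin n) → ℝ := fun u => supportFun A u - supportFun B u
  have hf : ∀ (c : ℝ) u, 0 ≤ c → f (c • u) = c * f u := fun c u hc => by
    simp only [f, supportFun_smul hA hAne hc, supportFun_smul hB hBne hc, mul_sub]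
  have hsimplex : ∀ v : Fin (n + 1) → EuclideanSpace ℝ (Fin n), IsSimplexNormals v →
      ∑ i, f (v i) ≤ 0 := fun v hv => by
    rw [Finset.sum_sub_distrib, sub_nonpos]
    refine hv.sum_supportFun_le hn hA hAne hB fun R hR => ?_
    obtain ⟨Δ, hΔ⟩ := hv.exists_simplex hR
    rw [← hΔ]
    exact hvol Δ
  have hall : ∀ v : Fin (n + 1) → EuclideanSpace ℝ (Fin n), ∑ i, v i = 0 →
      ∑ i, f (v i) ≤ 0 := by
    intro v hv
    obtain ⟨e, he⟩ := exists_isSimplexNormals_perturbation v hv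
    set D := ∑ i, (supportFun A (-e i) + supportFun B (e i))
    refine le_of_forall_pos_le_add fun η hη => ?_
    obtain ⟨ε, hε0, hεη, hε⟩ := he (η / (|D| + 1)) (by positivity)
    -- Subadditivity bounds the change of `f` by `ε` times a constant, replacing a continuity
    -- argument.
    have hstep : ∀ i, f (v i) ≤ f (v i + ε • e i) +
        ε * (supportFun A (-e i) + supportFun B (e i)) := by
      intro i
      have h1 := supportFun_add_le hA hAne (v i + ε • e i) (ε • -e i)
      have h2 := supportFun_add_le hB hBne (v i) (ε • e i)
      rw [smul_neg, add_neg_cancel_right, ← smul_neg, supportFun_smul hA hAne hε0.le] at h1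
      rw [supportFun_smul hB hBne hε0.le] at h2
      simp only [f]
      linarith
    have h1 := Finset.sum_le_sum fun i (_ : i ∈ Finset.univ) => hstep i
    rw [Finset.sum_add_distrib, ← Finset.mul_sum] at h1
    have h2 := hsimplex _ hε
    rw [lt_div_iff₀ (by positivity)] at hεη
    have h3 : ε * D ≤ ε * (|D| + 1) :=
      mul_le_mul_of_nonneg_left (by linarith [le_abs_self D]) hε0.le
    linarith
  obtain ⟨φ, hφ⟩ := exists_linearMap_ge_of_sum_nonpos hf
    (sum_nonpos_of_sum_nonpos_of_finrank_add_one hf (by rwa [finrank_euclideanSpace_fin]))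
  exact exists_subset_add_singleton_of_supportFun_sub_le hA hB hBc φ hφ hBne

end Volume

theorem mainTheorem3 (n : ℕ) (hn : 1 ≤ n) (A B : ConvexBody (EuclideanSpace ℝ (Fin n)))
    (hA : (interior (A : Set (EuclideanSpace ℝ (Fin n)))).Nonempty)
    (hB : (interior (B : Set (EuclideanSpace ℝ (Fin n)))).Nonempty) :
    ((∀ K : ConvexBody (EuclideanSpace ℝ (Fin n)),
        (interior (K : Set (EuclideanSpace ℝ (Fin n)))).Nonempty →
        volume ((A : Set (EuclideanSpace ℝ (Fin n))) + (K : Set (EuclideanSpace ℝ (Fin n)))) ≤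
          volume ((B : Set (EuclideanSpace ℝ (Fin n))) + (K : Set (EuclideanSpace ℝ (Fin n))))) →
      ∃ x₀ : EuclideanSpace ℝ (Fin n),
        (A : Set (EuclideanSpace ℝ (Fin n))) ⊆ (B : Set (EuclideanSpace ℝ (Fin n))) + {x₀}) ∧
    ((∀ Δ : Affine.Simplex ℝ (EuclideanSpace ℝ (Fin n)) n,
        volume ((A : Set (EuclideanSpace ℝ (Fin n))) + convexHull ℝ (Set.range Δ.points)) ≤
          volume ((B : Set (EuclideanSpace ℝ (Fin n))) + convexHull ℝ (Set.range Δ.points))) →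
      ∃ x₀ : EuclideanSpace ℝ (Fin n),
        (A : Set (EuclideanSpace ℝ (Fin n))) ⊆ (B : Set (EuclideanSpace ℝ (Fin n))) + {x₀}) := by
  have key := exists_subset_add_singleton_of_volume_add_simplex_le hn A.isCompact A.nonempty
    B.isCompact B.convex B.nonempty
  refine ⟨fun h => key fun Δ => ?_, key⟩
  exact h ⟨convexHull ℝ (Set.range Δ.points), convex_convexHull ℝ _,
    (Set.finite_range Δ.points).isCompact_convexHull (𝕜 := ℝ),
    (Set.range_nonempty Δ.points).convexHull⟩ Δ.interior_convexHull_nonempty
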